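/- **Theorem 4.1.** Let $R$ be a commutative Artinian ring, let $\Lambda$ be an Artin $R$-algebra (an $R$-algebra that is finitely generated as an $R$-module), and let all modules be finitely generated left $\Lambda$-modules. For a module $M$ with minimal projective presentation $P_1(M)\xrightarrow{d}P_0(M)\to M\to 0$ put $$\tau M=\operatorname{Hom}_R\bigl(\operatorname{coker}\bigl(\operatorname{Hom}_\Lambda(P_0(M),\Lambda)\xrightarrow{-\circ d}\operatorname{Hom}_\Lambda(P_1(M),\Lambda)\bigr),\,E\bigr),$$ where $E$ is the injective envelope of $R/\operatorname{rad}R$, and call $M$ $\tau$-rigid if $\operatorname{Hom}_\Lambda(M,\tau M)=0$. Let $S$ be a simple $\Lambda$-module with projective cover $\pi:P_0(S)\to S$, and assume that the first syzygy $\Omega^1S=\ker\pi$ is non-zero and semisimple. (1) Suppose that $S$ is not isomorphic to a direct summand of $\Omega^1S$. Let $S_1$ be a simple submodule of $\Omega^1S$, and let $m$ be the maximal integer such that $S_1^m$ is isomorphic to a direct summand of $\Omega^1S$. Then, regarding $S_1^m$ as a direct summand of $\Omega^1 S$, there is an exact sequence $$0\to \Omega^1S/S_1^m\to P_0(S)\to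 M\to 0$$ with $M$ indecomposable and $\tau$-rigid. (2) Suppose that $S$ is isomorphic to a direct summand of $\Omega^1S$, and let $n$ be the maximal integer such that $S^n$ is isomorphic to a direct summand of $\Omega^1S$. (a) If $\Omega^1S\cong S^n$, then there is no non-projective indecomposable $\tau$-rigid module $N$ whose projective cover $P_0(N)$ is isomorphic to $P_0(S)$. (b) If $\Omega^1S\not\cong S^n$, then, regarding $S^n$ as a direct summand of $\Omega^1 S$, there is an exact sequence $$0\to \Omega^1S/S^n\to P_0(S)\to N\to 0$$ with $N$ indecomposable, non-projective and $\tau$-rigid. -/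

import Mathlib

universe u v w

section ModuleNotions

variable {Λ : Type v} [Ring Λ]

/-- `π : P → M` is a projective cover: `P` is projective and `π` is a surjection whose kernel is
superfluous, i.e. no proper submodule of `P` together with `ker π` spans `P`. -/
structure IsProjectiveCover {P M : Type*} [AddCommGroup P] [Module Λ P]
    [AddCommGroup M] [Module Λ M] (π : P →ₗ[Λ] M) : Prop where
  projective : Module.Projective Λ P
  surjective : Function.Surjective π
  superfluous : ∀ N : Submodule Λ P, N ⊔ LinearMap.ker π = ⊤ → N = ⊤

/-- `P₁ --d--> P₀ --π--> M → 0` is a minimal projective presentation of `M`: `π` is a projective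
cover, the image of `d` is `ker π`, and `d` is a projective cover of its image. -/
structure IsMinimalProjectivePresentation {P₁ P₀ M : Type*} [AddCommGroup P₁] [Module Λ P₁]
    [AddCommGroup P₀] [Module Λ P₀] [AddCommGroup M] [Module Λ M]
    (d : P₁ →ₗ[Λ] P₀) (π : P₀ →ₗ[Λ] M) : Prop where
  cover : IsProjectiveCover π
  exact : LinearMap.range d = LinearMap.ker π
  cover_syzygy : IsProjectiveCover d.rangeRestrict

/-- `ι : A → E` is an injective envelope: `E` is injective and `ι` is an injection whose image is
essential, i.e. meets every non-zero submodule of `E` non-trivially. -/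
structure IsInjectiveEnvelope {A E : Type v} [AddCommGroup A] [Module Λ A]
    [AddCommGroup E] [Module Λ E] (ι : A →ₗ[Λ] E) : Prop where
  injective_module : Module.Injective Λ E
  injective : Function.Injective ι
  essential : ∀ N : Submodule Λ E, N ⊓ LinearMap.range ι = ⊥ → N = ⊥

variable (Λ)

/-- `M` is indecomposable: it is non-zero and not a direct sum of two non-zero submodules. -/
def IsIndecomposableModule (M : Type*) [AddCommGroup M] [Module Λ M] : Prop :=
  Nontrivial M ∧ ∀ A B : Submodule Λ M, IsCompl A B → A = ⊥ ∨ B = ⊥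

/-- `X` is isomorphic to a direct summand of `M`. -/
def IsDirectSummand (X M : Type*) [AddCommGroup X] [Module Λ X] [AddCommGroup M] [Module Λ M] :
    Prop :=
  ∃ A B : Submodule Λ M, IsCompl A B ∧ Nonempty (X ≃ₗ[Λ] A)

/-- `m` is the maximal integer such that `X ^ m` is a direct summand of `M`. -/
def IsMaximalMultiplicity (X M : Type*) [AddCommGroup X] [Module Λ X]
    [AddCommGroup M] [Module Λ M] (m : ℕ) : Prop :=
  IsGreatest {k : ℕ | IsDirectSummand Λ (Fin k → X) M} m

end ModuleNotions

section Dual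

variable (R : Type u) [CommRing R] (Λ : Type v) [Ring Λ]
  (E : Type u) [AddCommGroup E] [Module R E]
  (X : Type w) [AddCommGroup X] [Module R X] [Module Λᵐᵒᵖ X] [SMulCommClass R Λᵐᵒᵖ X]

/-- The group `Hom_R(X, E)` for a right `Λ`-module `X`; it is a left `Λ`-module below. -/
def RightModuleDual : Type (max u w) := X →ₗ[R] E

instance : AddCommGroup (RightModuleDual R E X) :=
  inferInstanceAs (AddCommGroup (X →ₗ[R] E))

/-- The left action on `Hom_R(X, E)` is `(a • φ) x = φ (x a)`, the right action of `a` on `x`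
being written `MulOpposite.op a • x`. -/
instance : Module Λ (RightModuleDual R E X) where
  smul a φ :=
    ({ toFun := fun x => (show X →ₗ[R] E from φ) (MulOpposite.op a • x)
       map_add' := fun x y => by rw [smul_add, map_add]
       map_smul' := fun c x => by
        rw [← smul_comm, map_smul, RingHom.id_apply] } : X →ₗ[R] E)
  one_smul φ := LinearMap.ext fun x =>
    congrArg (show X →ₗ[R] E from φ) (one_smul Λᵐᵒᵖ x)
  mul_smul a b φ := LinearMap.ext fun x =>
    congrArg (show X →ₗ[R] E from φ) (mul_smul (MulOpposite.op b) (MulOpposite.op a) x)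
  smul_zero a := LinearMap.ext fun _ => rfl
  smul_add a φ ψ := LinearMap.ext fun _ => rfl
  add_smul a b φ := LinearMap.ext fun x =>
    (congrArg (show X →ₗ[R] E from φ)
      (add_smul (MulOpposite.op a) (MulOpposite.op b) x)).trans
        (map_add (show X →ₗ[R] E from φ) _ _)
  zero_smul φ := LinearMap.ext fun x =>
    (congrArg (show X →ₗ[R] E from φ) (zero_smul Λᵐᵒᵖ x)).trans
      (map_zero (show X →ₗ[R] E from φ))

end Dual

section AuslanderReiten

variable (R : Type u) [CommRing R] {Λ : Type v} [Ring Λ] [Algebra R Λ]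

/-- The transpose attached to a presentation `d : P₁ → P₀`: the right `Λ`-module
`coker (Hom_Λ(P₀, Λ) → Hom_Λ(P₁, Λ))`, where the map is composition with `d`. -/
abbrev ARTranspose {P₁ P₀ : Type v} [AddCommGroup P₁] [Module Λ P₁]
    [AddCommGroup P₀] [Module Λ P₀] (d : P₁ →ₗ[Λ] P₀) : Type v :=
  (P₁ →ₗ[Λ] Λ) ⧸ LinearMap.range (LinearMap.lcomp Λᵐᵒᵖ Λ d)

/-- The Auslander-Reiten translate `Hom_R(Tr, E)` attached to a presentation `d : P₁ → P₀`, with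
`E` playing the role of the injective envelope of `R / rad R`. -/
abbrev ARTranslate (E : Type u) [AddCommGroup E] [Module R E]
    {P₁ P₀ : Type v} [AddCommGroup P₁] [Module Λ P₁]
    [AddCommGroup P₀] [Module Λ P₀] (d : P₁ →ₗ[Λ] P₀) : Type (max u v) :=
  RightModuleDual R E (ARTranspose d)

/-- `M` is `τ`-rigid: `M` is finitely generated and `Hom_Λ(M, τ M) = 0`. Here `τ M = D Tr M` is
computed from a minimal projective presentation of `M` and from an injective envelope `E` of
`R / rad R`; both are unique up to isomorphism. -/
def IsTauRigid (M : Type v) [AddCommGroup M] [Module Λ M] : Prop :=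
  Module.Finite Λ M ∧
  ∃ (P₁ P₀ : Type v) (_ : AddCommGroup P₁) (_ : Module Λ P₁)
    (_ : AddCommGroup P₀) (_ : Module Λ P₀) (d : P₁ →ₗ[Λ] P₀) (π : P₀ →ₗ[Λ] M)
    (E : Type u) (_ : AddCommGroup E) (_ : Module R E) (ι : (R ⧸ Ring.jacobson R) →ₗ[R] E),
    IsMinimalProjectivePresentation d π ∧ IsInjectiveEnvelope ι ∧
      ∀ f : M →ₗ[Λ] ARTranslate R E d, f = 0

end AuslanderReiten

/-! For a minimal presentation `d : P₁ → P₀` of M, `Hom(N, τM)` is dual to the cokernel of `Hom(P₀,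
N) → Hom(P₁, N)`. Hence it vanishes if `Hom(P₁, N) = 0` (`ARTranslate.eq_zero_of_hom_eq_zero`), and
when it vanishes every map `P₁ → N` factors through `d`
(`ARTranslate.exists_comp_eq_of_hom_eq_zero`).

For (1) and (2b), split `ker π = T ⊕ T'` with `T` the isotypic part, and take `M = P/T'`. Here `P₁`
covers the semisimple module `T'`. A map `P₁ → M` dies in S, since `T'` has no map onto S, so it
lands in `ker π / T' ≅ T`; there it dies because `T'` has no map onto the simple constituent of `T`
(`isTauRigid_quotient`).

For (2a), a non-projective N covered by P has `d ≠ 0` with image in `ker π ≅ S^n`. A non-zero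
coordinate `q : P₁ → S` of `d` lifts to `P₁ → P₀`. Pushed to N, this lift would factor through `d`,
which forces `q = 0` because maps `P₀ → S` kill the radical (`IsTauRigid.projective_of_isotypic`).
-/

/-! ### Projective covers: existence, uniqueness, maps to simple modules. -/

section ProjectiveCovers

variable {Λ : Type v} [Ring Λ]

theorem Submodule.sup_ker_eq_top_iff {P M : Type*} [AddCommGroup P] [Module Λ P]
    [AddCommGroup M] [Module Λ M] {f : P →ₗ[Λ] M} (hf : Function.Surjective f)
    (N : Submodule Λ P) : N ⊔ LinearMap.ker f = ⊤ ↔ N.map f = ⊤ := by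
  rw [← Submodule.comap_map_eq]
  refine ⟨fun h => ?_, fun h => by rw [h, Submodule.comap_top]⟩
  rw [← Submodule.map_comap_eq_of_surjective hf (N.map f), h, Submodule.map_top,
    LinearMap.range_eq_top.2 hf]

/-- A finitely generated module over an Artinian ring has a projective cover. -/
theorem exists_isProjectiveCover [IsArtinianRing Λ] (X : Type v) [AddCommGroup X] [Module Λ X]
    [Module.Finite Λ X] :
    ∃ (P : Type v) (_ : AddCommGroup P) (_ : Module Λ P) (p : P →ₗ[Λ] X),
      Module.Finite Λ P ∧ IsProjectiveCover p := by
  obtain ⟨n, f, hf⟩ := Module.Finite.exists_fin' Λ X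
  -- The cover is a minimal submodule `N` of the free module still mapping onto `X`. Minimality
  -- makes the lift `g` of `f` through `N` surjective on `N`, hence bijective, so `N` is a retract
  -- of the free module.
  obtain ⟨N, hN, hmin⟩ := WellFounded.has_min (wellFounded_lt (α := Submodule Λ (Fin n → Λ)))
    {N | N.map f = ⊤} ⟨⊤, by simpa using LinearMap.range_eq_top.2 hf⟩
  have hfN : Function.Surjective (f ∘ₗ N.subtype) := by
    rw [← LinearMap.range_eq_top, LinearMap.range_comp, Submodule.range_subtype]
    exact hN
  have hmin' : ∀ A : Submodule Λ N, A.map (f ∘ₗ N.subtype) = ⊤ → A = ⊤ := by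
    intro A hA
    have hle : A.map N.subtype ≤ N := Submodule.map_subtype_le N A
    have := hmin (A.map N.subtype) (by rw [Set.mem_ofPred_eq, ← Submodule.map_comp]; exact hA)
    have heq : A.map N.subtype = N := by
      by_contra hne
      exact this (lt_of_le_of_ne hle hne)
    apply Submodule.map_injective_of_injective N.injective_subtype
    rw [heq, Submodule.map_subtype_top]
  obtain ⟨g, hg⟩ := Module.projective_lifting_property (f ∘ₗ N.subtype) f hfN
  have hgN : Function.Surjective (g ∘ₗ N.subtype) := by
    rw [← LinearMap.range_eq_top]
    apply hmin'
    rw [← LinearMap.range_comp, ← LinearMap.comp_assoc, hg]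
    exact LinearMap.range_eq_top.2 hfN
  have hbij : Function.Bijective (g ∘ₗ N.subtype) :=
    ⟨IsNoetherian.injective_of_surjective_endomorphism _ hgN, hgN⟩
  have hproj : Module.Projective Λ N := by
    refine Module.Projective.of_split
      (N.subtype ∘ₗ (LinearEquiv.ofBijective _ hbij).symm.toLinearMap) g ?_
    refine LinearMap.ext fun x => ?_
    exact ((LinearEquiv.ofBijective _ hbij).apply_symm_apply x)
  exact ⟨N, inferInstance, inferInstance, f ∘ₗ N.subtype, inferInstance, hproj, hfN,
    fun A hA => hmin' A ((Submodule.sup_ker_eq_top_iff hfN A).1 hA)⟩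

namespace IsProjectiveCover

variable {P M X : Type*} [AddCommGroup P] [Module Λ P] [AddCommGroup M] [Module Λ M]
  [AddCommGroup X] [Module Λ X] {p : P →ₗ[Λ] M}

theorem finite (hp : IsProjectiveCover p) [Module.Finite Λ M] : Module.Finite Λ P := by
  obtain ⟨n, s, hs⟩ := Module.Finite.exists_fin (R := Λ) (M := M)
  choose t ht using fun i => hp.surjective (s i)
  have h : Submodule.span Λ (Set.range t) = ⊤ := by
    apply hp.superfluous
    rw [Submodule.sup_ker_eq_top_iff hp.surjective, Submodule.map_span, ← Set.range_comp, ← hs]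
    congr 2
    exact funext ht
  exact ⟨⟨(Set.finite_range t).toFinset, by simpa using h⟩⟩

/-- The kernel of a projective cover lies in the kernel of every map to a simple module. -/
theorem ker_le_ker (hp : IsProjectiveCover p) [IsSimpleModule Λ X] (g : P →ₗ[Λ] X) :
    LinearMap.ker p ≤ LinearMap.ker g := by
  rcases LinearMap.surjective_or_eq_zero g with hg | rfl
  · by_contra hle
    have hco := LinearMap.isCoatom_ker_of_surjective hg
    exact hco.1 (hp.superfluous _ (hco.2 _ (left_lt_sup.2 hle)))
  · simp

/-- A map from `P` to a simple module factors through any projective cover `P → M`. -/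
theorem exists_factorization (hp : IsProjectiveCover p) [IsSimpleModule Λ X] (g : P →ₗ[Λ] X) :
    ∃ g' : M →ₗ[Λ] X, g' ∘ₗ p = g := by
  refine ⟨(LinearMap.ker p).liftQ g (hp.ker_le_ker g) ∘ₗ
    (p.quotKerEquivOfSurjective hp.surjective).symm.toLinearMap, ?_⟩
  ext x
  have : (p.quotKerEquivOfSurjective hp.surjective).symm (p x) = Submodule.Quotient.mk x := by
    rw [LinearEquiv.symm_apply_eq]; rfl
  simp [this]

theorem comp_hom_eq_zero {M' : Type*} [AddCommGroup M'] [Module Λ M'] (hp : IsProjectiveCover p)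
    [IsSimpleModule Λ X] (e : M' ≃ₗ[Λ] M) (hM : ∀ g : M' →ₗ[Λ] X, g = 0) (h : P →ₗ[Λ] X) :
    h = 0 := by
  obtain ⟨g, rfl⟩ := hp.exists_factorization h
  refine LinearMap.ext fun y => ?_
  simpa using LinearMap.congr_fun (hM (g ∘ₗ e.toLinearMap)) (e.symm (p y))

/-- The source of a projective cover of a simple module is local. -/
theorem le_ker_of_ne_top (hp : IsProjectiveCover p) [IsSimpleModule Λ M] {N : Submodule Λ P}
    (hN : N ≠ ⊤) : N ≤ LinearMap.ker p := by
  by_contra hle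
  have hco := LinearMap.isCoatom_ker_of_surjective hp.surjective
  exact hN (hp.superfluous N (hco.2 _ (right_lt_sup.2 hle)))

theorem comp_equiv {P' : Type*} [AddCommGroup P'] [Module Λ P'] (hp : IsProjectiveCover p)
    (e : P' ≃ₗ[Λ] P) : IsProjectiveCover (p ∘ₗ e.toLinearMap) where
  projective := by
    have := hp.projective
    exact Module.Projective.of_equiv e.symm
  surjective := hp.surjective.comp e.surjective
  superfluous N hN := by
    have hs : Function.Surjective (p ∘ₗ e.toLinearMap) := hp.surjective.comp e.surjective
    rw [Submodule.sup_ker_eq_top_iff hs, Submodule.map_comp,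
      ← Submodule.sup_ker_eq_top_iff hp.surjective] at hN
    have := hp.superfluous _ hN
    apply Submodule.map_injective_of_injective e.injective
    rw [Submodule.map_top, LinearEquiv.range]
    exact this

/-- Projective covers are unique up to isomorphism. -/
theorem nonempty_equiv {P' : Type*} [AddCommGroup P'] [Module Λ P'] {p' : P' →ₗ[Λ] M}
    (hp : IsProjectiveCover p) (hp' : IsProjectiveCover p') : Nonempty (P ≃ₗ[Λ] P') := by
  have := hp.projective
  have := hp'.projective
  obtain ⟨f, hf⟩ := Module.projective_lifting_property p' p hp'.surjective
  have hfs : Function.Surjective f := by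
    rw [← LinearMap.range_eq_top]
    apply hp'.superfluous
    rw [Submodule.sup_ker_eq_top_iff hp'.surjective, ← LinearMap.range_comp, hf]
    exact LinearMap.range_eq_top.2 hp.surjective
  obtain ⟨g, hg⟩ := Module.projective_lifting_property f LinearMap.id hfs
  have hgs : LinearMap.range g = ⊤ := by
    apply hp.superfluous
    rw [Submodule.sup_ker_eq_top_iff hp.surjective, ← LinearMap.range_comp, ← hf,
      LinearMap.comp_assoc, hg, LinearMap.comp_id]
    exact LinearMap.range_eq_top.2 hp'.surjective
  refine ⟨(LinearEquiv.ofBijective g ⟨?_, LinearMap.range_eq_top.1 hgs⟩).symm⟩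
  exact (show Function.LeftInverse f g from fun x => LinearMap.congr_fun hg x).injective

end IsProjectiveCover

end ProjectiveCovers

/-! ### Existence of injective envelopes. -/

section InjectiveEnvelopes

variable {R : Type u} [Ring R]

theorem exists_injective_embedding (A : Type u) [AddCommGroup A] [Module R A] :
    ∃ (E : Type u) (_ : AddCommGroup E) (_ : Module R E) (j : A →ₗ[R] E),
      Module.Injective R E ∧ Function.Injective j := by
  obtain ⟨⟨I, hI, f, hf⟩⟩ := CategoryTheory.EnoughInjectives.presentation (ModuleCat.of R A)
  exact ⟨I, inferInstance, inferInstance, f.hom, Module.injective_module_of_injective_object R I,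
    (ModuleCat.mono_iff_injective f).1 hf⟩

/-- Inside an injective `I ⊇ A`, a maximal essential extension `E` of `A` is a direct summand: for
`C` maximal with `E ∩ C = 0`, injectivity of `I` extends the inclusion of `E` over `I / C`, which
yields a retraction `r` of `I` onto `E`. -/
theorem exists_isInjectiveEnvelope (A : Type u) [AddCommGroup A] [Module R A] :
    ∃ (E : Type u) (_ : AddCommGroup E) (_ : Module R E) (ι : A →ₗ[R] E),
      IsInjectiveEnvelope ι := by
  obtain ⟨I, _, _, j, hI, hj⟩ := exists_injective_embedding (R := R) A
  obtain ⟨E, hAE, hE⟩ := zorn_le_nonempty₀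
    {E : Submodule R I | ∀ N ≤ E, N ⊓ LinearMap.range j = ⊥ → N = ⊥} (by
      intro c hc hchain y hy
      refine ⟨sSup c, fun N hN hNA => ?_, fun z hz => le_sSup hz⟩
      rw [Submodule.eq_bot_iff]
      intro x hx
      obtain ⟨F, hF, hxF⟩ :=
        (Submodule.mem_sSup_of_directed ⟨y, hy⟩ hchain.directedOn).1 (hN hx)
      have h := hc hF (R ∙ x) ((Submodule.span_singleton_le_iff_mem x F).2 hxF)
        (le_bot_iff.1 ((inf_le_inf_right _
          ((Submodule.span_singleton_le_iff_mem x N).2 hx)).trans hNA.le))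
      exact Submodule.span_singleton_eq_bot.1 h) (LinearMap.range j)
      (fun N hN h => by rwa [inf_eq_left.2 hN] at h)
  obtain ⟨C, hC⟩ := zorn_le₀ {C : Submodule R I | Disjoint E C} (by
    intro c hc hchain
    exact ⟨sSup c, hchain.directedOn.disjoint_sSup_right.2 fun z hz => hc hz,
      fun z hz => le_sSup hz⟩)
  have hinj : Function.Injective (C.mkQ ∘ₗ E.subtype) := by
    rw [← LinearMap.ker_eq_bot, LinearMap.ker_comp, Submodule.ker_mkQ,
      ← Submodule.disjoint_iff_comap_eq_bot]
    exact hC.1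
  obtain ⟨g, hg⟩ := hI.out _ hinj E.subtype
  let r : I →ₗ[R] I := g ∘ₗ C.mkQ
  have hr : ∀ x ∈ E, r x = x := fun x hx => hg ⟨x, hx⟩
  have hCr : C ≤ LinearMap.ker r := fun x hx => by
    simp [r, (Submodule.Quotient.mk_eq_zero C).2 hx]
  have hmaxC : ∀ N : Submodule R I, C ≤ N → N ⊓ E = ⊥ → N ≤ C := fun N hN h =>
    hC.2 (show Disjoint E N from disjoint_iff.2 (by rwa [inf_comm])) hN
  -- By maximality of `E` it suffices that `range r` is essential over `A`. If `N ≤ range r` misses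
  -- `A`, its preimage under `r` contains `C` and misses `E`, so it equals `C`, which `r` kills.
  have hrange : LinearMap.range r ≤ E := by
    refine hE.2 (fun N hN hNA => ?_) fun x hx => ⟨x, hr x hx⟩
    have h1 : N ⊓ E = ⊥ := hE.1 _ inf_le_right
      (le_bot_iff.1 ((inf_le_inf_right _ inf_le_left).trans hNA.le))
    have h2 : N.comap r ≤ C := by
      apply hmaxC
      · exact hCr.trans (Submodule.comap_mono bot_le)
      · rw [Submodule.eq_bot_iff]
        rintro x ⟨hx, hxE⟩
        rw [SetLike.mem_coe, Submodule.mem_comap, hr x hxE] at hx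
        exact (Submodule.eq_bot_iff _).1 h1 x ⟨hx, hxE⟩
    rw [Submodule.eq_bot_iff]
    intro y hy
    obtain ⟨x, rfl⟩ := hN hy
    exact hCr (h2 hy)
  refine ⟨E, inferInstance, inferInstance, j.codRestrict E fun x => hAE ⟨x, rfl⟩, ⟨?_⟩, ?_, ?_⟩
  · intro X Y _ _ _ _ f hf φ
    obtain ⟨h, hh⟩ := hI.out f hf (E.subtype ∘ₗ φ)
    refine ⟨r.codRestrict E (fun x => hrange ⟨x, rfl⟩) ∘ₗ h, fun x => Subtype.ext ?_⟩
    simp only [LinearMap.comp_apply, LinearMap.codRestrict_apply, hh]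
    exact hr _ (φ x).2
  · exact fun x y h => hj (congrArg Subtype.val h)
  · intro N hN
    apply Submodule.map_injective_of_injective E.injective_subtype
    rw [Submodule.map_bot]
    refine hE.1 _ (Submodule.map_subtype_le E N) ?_
    rw [Submodule.eq_bot_iff]
    rintro _ ⟨⟨x, hx, rfl⟩, ⟨a, ha⟩⟩
    have : x ∈ N ⊓ LinearMap.range (j.codRestrict E fun x => hAE ⟨x, rfl⟩) :=
      ⟨hx, a, Subtype.ext ha⟩
    rw [hN, Submodule.mem_bot] at this
    simp [this]

end InjectiveEnvelopes

/-! ### The envelope of `R / rad R` detects non-zero modules. -/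

section Cogenerator

/-- The injective envelope of `R / rad R` is a cogenerator when `R` is Artinian. -/
theorem IsInjectiveEnvelope.exists_ne_zero {R : Type u} [CommRing R] [IsArtinianRing R]
    {E : Type u} [AddCommGroup E] [Module R E] {ι : (R ⧸ Ring.jacobson R) →ₗ[R] E}
    (hι : IsInjectiveEnvelope ι) (C : Type w) [AddCommGroup C] [Module R C] [Nontrivial C] :
    ∃ f : C →ₗ[R] E, f ≠ 0 := by
  have := hι.injective_module
  obtain ⟨c, hc⟩ := exists_ne (0 : C)
  -- The map sought extends `Rc ≅ R/I → R/m → R/rad R → E`, where `R/m` embeds in `R/rad R` because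
  -- the latter is semisimple.
  let I : Ideal R := LinearMap.ker (LinearMap.toSpanSingleton R C c)
  have hI : I ≠ ⊤ := by
    rw [Ideal.ne_top_iff_one]
    simpa [I] using hc
  obtain ⟨m, hm, hIm⟩ := Ideal.exists_le_maximal I hI
  have hss : IsSemisimpleModule R (R ⧸ Ring.jacobson R) := by
    let e : (R ⧸ Ring.jacobson R) →ₛₗ[Ideal.Quotient.mk (Ring.jacobson R)]
        (R ⧸ Ring.jacobson R) :=
      { toFun := id, map_add' := fun _ _ => rfl, map_smul' := fun r x => by
          simp [Algebra.smul_def] }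
    have : RingHomSurjective (Ideal.Quotient.mk (Ring.jacobson R)) :=
      ⟨Ideal.Quotient.mk_surjective⟩
    exact (e.isSemisimpleModule_iff_of_bijective Function.bijective_id).2 inferInstance
  obtain ⟨s, hs⟩ := IsSemisimpleModule.lifting_property
    (Submodule.factor (Ring.jacobson_le_of_isMaximal m)) (Submodule.factor_surjective _)
    (LinearMap.id (R := R) (M := R ⧸ m))
  obtain ⟨h, hh⟩ := Module.Injective.extension_property R E (R ⧸ I) C
    (I.liftQ (LinearMap.toSpanSingleton R C c) le_rfl)
    (LinearMap.ker_eq_bot.1 (Submodule.ker_liftQ_eq_bot _ _ _ le_rfl))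
    (ι ∘ₗ s ∘ₗ Submodule.factor hIm)
  refine ⟨h, fun h0 => ?_⟩
  have h1 := LinearMap.congr_fun hh (Submodule.Quotient.mk 1)
  rw [h0, LinearMap.zero_comp, LinearMap.zero_apply, LinearMap.comp_apply,
    eq_comm, map_eq_zero_iff ι hι.injective] at h1
  have h2 := LinearMap.congr_fun hs (Submodule.factor hIm (Submodule.Quotient.mk 1))
  rw [LinearMap.comp_apply, ← LinearMap.comp_apply s, h1, map_zero] at h2
  have h3 : (Submodule.Quotient.mk 1 : R ⧸ m) = 0 := h2.symm
  rw [Submodule.Quotient.mk_eq_zero] at h3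
  exact hm.ne_top ((Ideal.eq_top_iff_one m).2 h3)

end Cogenerator

/-! ### Dual bases of finitely generated projective modules. -/

section DualBasis

variable {Λ : Type v} [Ring Λ]

theorem Module.Projective.exists_dual_basis (P : Type w) [AddCommGroup P] [Module Λ P]
    [Module.Finite Λ P] [Module.Projective Λ P] :
    ∃ (n : ℕ) (x : Fin n → P) (ξ : Fin n → (P →ₗ[Λ] Λ)), ∀ y, ∑ i, ξ i y • x i = y := by
  obtain ⟨n, f, hf⟩ := Module.Finite.exists_fin' Λ P
  obtain ⟨s, hs⟩ := Module.projective_lifting_property f LinearMap.id hf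
  refine ⟨n, fun i => f (Pi.single i 1), fun i => LinearMap.proj i ∘ₗ s, fun y => ?_⟩
  conv_rhs => rw [← LinearMap.id_apply (R := Λ) y, ← hs, LinearMap.comp_apply,
    pi_eq_sum_univ' (s y), map_sum]
  simp only [map_smul, LinearMap.comp_apply, LinearMap.proj_apply]

end DualBasis

/-! ### Maps into the Auslander-Reiten translate. -/

section Translate

variable (R : Type u) [CommRing R] {Λ : Type v} [Ring Λ] [Algebra R Λ]
  (E : Type u) [AddCommGroup E] [Module R E]
  {P₁ P₀ : Type v} [AddCommGroup P₁] [Module Λ P₁] [AddCommGroup P₀] [Module Λ P₀]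
  (d : P₁ →ₗ[Λ] P₀) (N : Type v) [AddCommGroup N] [Module Λ N]

theorem ARTranslate.smul_apply (a : Λ) (φ : ARTranslate R E d) (ψ : P₁ →ₗ[Λ] Λ) :
    (show ARTranspose d →ₗ[R] E from a • φ) (Submodule.Quotient.mk ψ) =
      (show ARTranspose d →ₗ[R] E from φ) (Submodule.Quotient.mk (MulOpposite.op a • ψ)) :=
  rfl

variable {R E d N}

/-- By the dual basis, `φ` is a sum of terms `ξ i · φ (x i)`, and moving the scalar across gives `f
y (ξ i · φ (x i)) = f (φ (x i) • y) (ξ i)`. Here `φ (x i) • y = 0`, as `z ↦ φ z • y` is a map `P₁ →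
N`. -/
theorem ARTranslate.eq_zero_of_hom_eq_zero [Module.Finite Λ P₁] [Module.Projective Λ P₁]
    (hN : ∀ h : P₁ →ₗ[Λ] N, h = 0) (f : N →ₗ[Λ] ARTranslate R E d) : f = 0 := by
  obtain ⟨n, x, ξ, hx⟩ := Module.Projective.exists_dual_basis (Λ := Λ) P₁
  refine LinearMap.ext fun y => ?_
  change (show ARTranspose d →ₗ[R] E from f y) = 0
  refine LinearMap.ext fun q => ?_
  obtain ⟨φ, rfl⟩ := Submodule.Quotient.mk_surjective _ q
  have hφ : φ = ∑ i, MulOpposite.op (φ (x i)) • ξ i := by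
    ext z
    conv_lhs => rw [← hx z, map_sum]
    simp
  have hz : ∀ i, φ (x i) • y = 0 := fun i =>
    LinearMap.congr_fun (hN (LinearMap.toSpanSingleton Λ N y ∘ₗ φ)) (x i)
  rw [hφ, ← Submodule.mkQ_apply, map_sum, map_sum, LinearMap.zero_apply]
  refine Finset.sum_eq_zero fun i _ => ?_
  rw [Submodule.mkQ_apply, ← ARTranslate.smul_apply, ← map_smul, hz, map_zero]
  rfl

/-- A non-zero functional `l` on the cokernel of `Hom(P₀, N) → Hom(P₁, N)` would give the map `y ↦
(φ ↦ l (φ(·) • y))` from `N` to the translate. That map is zero, yet the homomorphisms `φ(·) • y`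
generate `Hom(P₁, N)`, so `l = 0`. -/
theorem ARTranslate.exists_comp_eq_of_hom_eq_zero [IsArtinianRing R]
    {ι : (R ⧸ Ring.jacobson R) →ₗ[R] E} (hι : IsInjectiveEnvelope ι)
    [Module.Finite Λ P₁] [Module.Projective Λ P₁]
    (hN : ∀ f : N →ₗ[Λ] ARTranslate R E d, f = 0) (h : P₁ →ₗ[Λ] N) :
    ∃ g : P₀ →ₗ[Λ] N, g ∘ₗ d = h := by
  let _ : Module R N := Module.compHom N (algebraMap R Λ)
  have : IsScalarTower R Λ N := IsScalarTower.of_algebraMap_smul fun _ _ => rfl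
  by_contra hne
  have hnt : Nontrivial ((P₁ →ₗ[Λ] N) ⧸ LinearMap.range (LinearMap.lcomp R N d)) := by
    rw [Submodule.Quotient.nontrivial_iff]
    intro htop
    obtain ⟨g, hg⟩ := (htop ▸ Submodule.mem_top : h ∈ LinearMap.range (LinearMap.lcomp R N d))
    exact hne ⟨g, hg⟩
  obtain ⟨l, hl⟩ := hι.exists_ne_zero
    ((P₁ →ₗ[Λ] N) ⧸ LinearMap.range (LinearMap.lcomp R N d))
  let l' : (P₁ →ₗ[Λ] N) →ₗ[R] E := l ∘ₗ Submodule.mkQ _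
  have hl' : ∀ g : P₀ →ₗ[Λ] N, l' (g ∘ₗ d) = 0 := fun g => by
    have : (Submodule.Quotient.mk (g ∘ₗ d) :
        (P₁ →ₗ[Λ] N) ⧸ LinearMap.range (LinearMap.lcomp R N d)) = 0 :=
      (Submodule.Quotient.mk_eq_zero _).2 ⟨g, rfl⟩
    simp [l', this]
  let c : N → (P₁ →ₗ[Λ] Λ) →ₗ[R] (P₁ →ₗ[Λ] N) := fun y =>
    { toFun := fun φ => LinearMap.toSpanSingleton Λ N y ∘ₗ φ
      map_add' := fun φ ψ => LinearMap.comp_add _ _ _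
      map_smul' := fun r φ => by ext z; simp }
  let F : N → (ARTranspose d →ₗ[R] E) := fun y =>
    ((LinearMap.range (LinearMap.lcomp Λᵐᵒᵖ Λ d)).restrictScalars R).liftQ (l' ∘ₗ c y) (by
      rintro _ ⟨ψ, rfl⟩
      exact hl' (LinearMap.toSpanSingleton Λ N y ∘ₗ ψ))
  have hF : ∀ y φ, F y (Submodule.Quotient.mk φ) = l' (LinearMap.toSpanSingleton Λ N y ∘ₗ φ) :=
    fun _ _ => rfl
  let f : N →ₗ[Λ] ARTranslate R E d :=
    { toFun := F
      map_add' := fun y z => by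
        refine LinearMap.ext fun q => ?_
        obtain ⟨φ, rfl⟩ := Submodule.Quotient.mk_surjective _ q
        change F (y + z) _ = F y _ + F z _
        rw [hF, hF, hF, ← map_add]
        congr 1
        ext x
        simp
      map_smul' := fun a y => by
        refine LinearMap.ext fun q => ?_
        obtain ⟨φ, rfl⟩ := Submodule.Quotient.mk_surjective _ q
        change F (a • y) _ = F y (Submodule.Quotient.mk (MulOpposite.op a • φ))
        rw [hF, hF]
        congr 1
        ext x
        simp [mul_smul] }
  have hf := hN f
  have hzero : ∀ y φ, l' (LinearMap.toSpanSingleton Λ N y ∘ₗ φ) = 0 := fun y φ => by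
    rw [← hF]
    exact LinearMap.congr_fun
      (show (show ARTranspose d →ₗ[R] E from f y) = 0 by rw [hf]; rfl) _
  obtain ⟨n, x, ξ, hx⟩ := Module.Projective.exists_dual_basis (Λ := Λ) P₁
  apply hl
  refine LinearMap.ext fun q => ?_
  obtain ⟨k, rfl⟩ := Submodule.Quotient.mk_surjective _ q
  have hk : k = ∑ i, LinearMap.toSpanSingleton Λ N (k (x i)) ∘ₗ ξ i := by
    ext z
    conv_lhs => rw [← hx z, map_sum]
    simp
  change l' k = 0
  rw [hk, map_sum]
  exact Finset.sum_eq_zero fun i _ => hzero _ _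

end Translate

/-! ### Multiplicities in semisimple modules; quotients of a projective cover. -/

section Modules

variable {Λ : Type v} [Ring Λ]

theorem IsDirectSummand.of_injective {X M : Type*} [AddCommGroup X] [Module Λ X]
    [AddCommGroup M] [Module Λ M] [IsSemisimpleModule Λ M] {f : X →ₗ[Λ] M}
    (hf : Function.Injective f) : IsDirectSummand Λ X M := by
  obtain ⟨B, hB⟩ := exists_isCompl (LinearMap.range f)
  exact ⟨_, B, hB, ⟨LinearEquiv.ofInjective f hf⟩⟩

/-- A complement of the `X`-isotypic part of a semisimple module has no map onto `X`. -/
theorem IsMaximalMultiplicity.hom_eq_zero {X M : Type*} [AddCommGroup X] [Module Λ X]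
    [IsSimpleModule Λ X] [AddCommGroup M] [Module Λ M] [IsSemisimpleModule Λ M] {m : ℕ}
    (hm : IsMaximalMultiplicity Λ X M m) {T T' : Submodule Λ M} (hT : Disjoint T T')
    (e : (Fin m → X) ≃ₗ[Λ] T) (g : T' →ₗ[Λ] X) : g = 0 := by
  by_contra hg
  obtain ⟨s, hs⟩ := IsSemisimpleModule.lifting_property g (LinearMap.surjective_of_ne_zero hg)
    LinearMap.id
  have hsi : Function.Injective s :=
    (show Function.LeftInverse g s from fun x => LinearMap.congr_fun hs x).injective
  -- A copy of `X` in `T'` beside `X ^ m ≅ T` embeds `X ^ (m + 1)`, against maximality.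
  let F : (X × (Fin m → X)) →ₗ[Λ] M :=
    (T'.subtype ∘ₗ s).coprod (T.subtype ∘ₗ e.toLinearMap)
  have hF : Function.Injective F := by
    rw [← LinearMap.ker_eq_bot, LinearMap.ker_eq_bot']
    rintro ⟨x, y⟩ h
    have h' : (s x : M) + (e y : M) = 0 := h
    have h1 : (s x : M) ∈ T := by
      rw [eq_neg_of_add_eq_zero_left h']
      exact T.neg_mem (e y).2
    have h2 : (s x : M) = 0 := Submodule.disjoint_def.1 hT _ h1 (s x).2
    have h3 : (e y : M) = 0 := by rwa [h2, zero_add] at h'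
    have hx : x = 0 := (map_eq_zero_iff s hsi).1 (Subtype.ext h2)
    have hy : y = 0 := (map_eq_zero_iff e e.injective).1 (Subtype.ext h3)
    rw [hx, hy]; rfl
  have := hm.2 (IsDirectSummand.of_injective (Λ := Λ)
    (f := F ∘ₗ (Fin.consLinearEquiv Λ fun _ : Fin (m + 1) => X).symm.toLinearMap)
    (hF.comp (LinearEquiv.injective _)))
  omega

/-- A non-zero quotient of the projective cover of a simple module is indecomposable. -/
theorem IsProjectiveCover.isIndecomposableModule_quotient {P S : Type*} [AddCommGroup P]
    [Module Λ P] [AddCommGroup S] [Module Λ S] [IsSimpleModule Λ S] {π : P →ₗ[Λ] S}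
    (hπ : IsProjectiveCover π) {K : Submodule Λ P} (hK : K ≤ LinearMap.ker π) :
    IsIndecomposableModule Λ (P ⧸ K) := by
  have := IsSimpleModule.nontrivial Λ S
  -- All proper submodules lie in the single maximal one, so two of them cannot span.
  have hle : ∀ A : Submodule Λ (P ⧸ K), A ≠ ⊤ → A.comap K.mkQ ≤ LinearMap.ker π := by
    refine fun A hA => hπ.le_ker_of_ne_top fun h => hA ?_
    rw [← Submodule.map_comap_eq_of_surjective K.mkQ_surjective A, h, Submodule.map_top,
      Submodule.range_mkQ]
  refine ⟨Submodule.Quotient.nontrivial_iff.2 fun h => ?_, fun A B hAB => ?_⟩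
  · exact (LinearMap.isCoatom_ker_of_surjective hπ.surjective).1 (top_le_iff.1 (h ▸ hK))
  by_cases hA : A = ⊤
  · right
    simpa [hA] using hAB.inf_eq_bot
  by_cases hB : B = ⊤
  · left
    simpa [hB] using hAB.inf_eq_bot
  exfalso
  have htop : A ⊔ B = ⊤ := hAB.sup_eq_top
  apply (LinearMap.isCoatom_ker_of_surjective hπ.surjective).1
  rw [Submodule.eq_top_iff']
  intro x
  obtain ⟨a, ha, b, hb, hab⟩ :=
    Submodule.mem_sup.1 (htop ▸ Submodule.mem_top : K.mkQ x ∈ A ⊔ B)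
  obtain ⟨a, rfl⟩ := K.mkQ_surjective a
  have h1 : a ∈ LinearMap.ker π := hle A hA ha
  have h2 : x - a ∈ LinearMap.ker π := by
    apply hle B hB
    rw [Submodule.mem_comap, map_sub, ← hab, add_sub_cancel_left]
    exact hb
  simpa using Submodule.add_mem _ h2 h1

theorem IsProjectiveCover.not_projective_quotient {P M : Type*} [AddCommGroup P]
    [Module Λ P] [AddCommGroup M] [Module Λ M] {π : P →ₗ[Λ] M}
    (hπ : IsProjectiveCover π) {K : Submodule Λ P} (hK : K ≤ LinearMap.ker π) (hne : K ≠ ⊥) :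
    ¬ Module.Projective Λ (P ⧸ K) := by
  intro h
  obtain ⟨s, hs⟩ := Module.projective_lifting_property K.mkQ LinearMap.id K.mkQ_surjective
  have hrange : LinearMap.range s = ⊤ := by
    apply hπ.superfluous
    rw [eq_top_iff]
    refine le_trans ?_ (sup_le_sup_left hK _)
    have := (Submodule.sup_ker_eq_top_iff K.mkQ_surjective (LinearMap.range s)).2 (by
      rw [← LinearMap.range_comp, hs, LinearMap.range_id])
    rw [Submodule.ker_mkQ] at this
    exact this.ge
  apply hne
  rw [Submodule.eq_bot_iff]
  intro x hx
  obtain ⟨y, rfl⟩ := (hrange ▸ Submodule.mem_top : x ∈ LinearMap.range s)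
  have hy : K.mkQ (s y) = y := LinearMap.congr_fun hs y
  rw [← hy, Submodule.mkQ_apply, (Submodule.Quotient.mk_eq_zero K).2 hx, map_zero]

end Modules

/-! ### The criteria for and against τ-rigidity. -/

section TauRigid

variable (R : Type u) [CommRing R] [IsArtinianRing R] {Λ : Type v} [Ring Λ] [Algebra R Λ]
  [Module.Finite R Λ]

/-- Serves both existence statements: `X` is `S₁` in (1) and `S` in (2b). -/
theorem isTauRigid_quotient {S P : Type v} [AddCommGroup S] [Module Λ S] [IsSimpleModule Λ S]
    [AddCommGroup P] [Module Λ P] {π : P →ₗ[Λ] S} (hπ : IsProjectiveCover π)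
    {X : Type w} [AddCommGroup X] [Module Λ X] [IsSimpleModule Λ X]
    {T T' : Submodule Λ (LinearMap.ker π)} (hT : IsCompl T T') {k : ℕ}
    (e : (Fin k → X) ≃ₗ[Λ] T) (hS : ∀ g : T' →ₗ[Λ] S, g = 0) (hX : ∀ g : T' →ₗ[Λ] X, g = 0) :
    IsTauRigid R (Λ := Λ) (P ⧸ T'.map (LinearMap.ker π).subtype) := by
  have : IsArtinianRing Λ := IsArtinianRing.of_finite R Λ
  have hfin : Module.Finite Λ P := hπ.finite
  have := hπ.projective
  set K : Submodule Λ P := T'.map (LinearMap.ker π).subtype with hKdef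
  have hK : K ≤ LinearMap.ker π := Submodule.map_subtype_le _ _
  let eK : T' ≃ₗ[Λ] K := Submodule.equivSubtypeMap _ T'
  obtain ⟨P₁, _, _, p, hfin₁, hp⟩ := exists_isProjectiveCover (Λ := Λ) K
  have := hp.projective
  obtain ⟨E, _, _, ι, hι⟩ := exists_isInjectiveEnvelope (R := R) (R ⧸ Ring.jacobson R)
  have hrange : LinearMap.range (K.subtype ∘ₗ p) = K := by
    rw [LinearMap.range_comp, LinearMap.range_eq_top.2 hp.surjective, Submodule.map_top,
      Submodule.range_subtype]
  have hhom : ∀ h : P₁ →ₗ[Λ] (P ⧸ K), h = 0 := by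
    intro h
    have hσ : K.liftQ π hK ∘ₗ h = 0 := hp.comp_hom_eq_zero eK hS _
    -- `Θ` identifies `T` with `ker π / K`, where `h` takes its values by `hσ`.
    let Θ : T →ₗ[Λ] (P ⧸ K) := K.mkQ ∘ₗ (LinearMap.ker π).subtype ∘ₗ T.subtype
    have hΘ : Function.Injective Θ := by
      rw [← LinearMap.ker_eq_bot, LinearMap.ker_eq_bot']
      intro t ht
      obtain ⟨t', ht', htt'⟩ := (Submodule.Quotient.mk_eq_zero K).1 ht
      have : t' = (t : LinearMap.ker π) := Subtype.ext htt'
      subst this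
      exact Subtype.ext (Submodule.disjoint_def.1 hT.disjoint _ t.2 ht')
    have hmem : ∀ y, h y ∈ LinearMap.range Θ := by
      intro y
      obtain ⟨z, hz⟩ := K.mkQ_surjective (h y)
      have hzπ : z ∈ LinearMap.ker π := by
        have := LinearMap.congr_fun hσ y
        rwa [LinearMap.comp_apply, ← hz] at this
      obtain ⟨t, ht, t', ht', htt'⟩ := Submodule.mem_sup.1
        (hT.sup_eq_top ▸ Submodule.mem_top : (⟨z, hzπ⟩ : LinearMap.ker π) ∈ T ⊔ T')
      refine ⟨⟨t, ht⟩, ?_⟩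
      rw [← hz]
      refine (Submodule.Quotient.eq' K).2 ?_
      refine ⟨t', ht', ?_⟩
      have := congrArg Subtype.val htt'
      simp only [Submodule.coe_add] at this
      simp [← this]
    let h' : P₁ →ₗ[Λ] (Fin k → X) := e.symm.toLinearMap ∘ₗ
      (LinearEquiv.ofInjective Θ hΘ).symm.toLinearMap ∘ₗ h.codRestrict _ hmem
    have hh' : h' = 0 := by
      refine LinearMap.ext fun y => funext fun i => ?_
      exact LinearMap.congr_fun (hp.comp_hom_eq_zero eK hX (LinearMap.proj i ∘ₗ h')) y
    refine LinearMap.ext fun y => ?_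
    have := LinearMap.congr_fun hh' y
    simp only [h', LinearMap.comp_apply, LinearEquiv.coe_coe, LinearMap.zero_apply,
      LinearEquiv.map_eq_zero_iff] at this
    exact congrArg Subtype.val this
  refine ⟨inferInstance, P₁, P, _, _, _, _, K.subtype ∘ₗ p, K.mkQ, E, _, _, ι, ⟨⟨hπ.projective,
    K.mkQ_surjective, fun N hN => hπ.superfluous N ?_⟩, ?_, ⟨hp.projective,
    LinearMap.surjective_rangeRestrict _, fun N hN => hp.superfluous N ?_⟩⟩, hι,
    fun f => ARTranslate.eq_zero_of_hom_eq_zero hhom f⟩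
  · rw [Submodule.ker_mkQ] at hN
    exact top_le_iff.1 (hN.ge.trans (sup_le_sup_left hK _))
  · rw [hrange, Submodule.ker_mkQ]
  · rwa [LinearMap.ker_rangeRestrict, LinearMap.ker_comp_of_ker_eq_bot _ K.ker_subtype] at hN

/-- If `ker (P → S)` is `S`-isotypic, a `τ`-rigid module with projective cover `P` is
projective. -/
theorem IsTauRigid.projective_of_isotypic {S P N Q : Type v} [AddCommGroup S] [Module Λ S]
    [IsSimpleModule Λ S] [AddCommGroup P] [Module Λ P] {π : P →ₗ[Λ] S} (hπ : IsProjectiveCover π)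
    {n : ℕ} (e : LinearMap.ker π ≃ₗ[Λ] (Fin n → S))
    [AddCommGroup N] [Module Λ N] [Nontrivial N] (hN : IsTauRigid R (Λ := Λ) N)
    [AddCommGroup Q] [Module Λ Q] {ρ : Q →ₗ[Λ] N} (hρ : IsProjectiveCover ρ) (eQ : Q ≃ₗ[Λ] P) :
    Module.Projective Λ N := by
  have : IsArtinianRing Λ := IsArtinianRing.of_finite R Λ
  obtain ⟨hfinN, P₁, P₀, _, _, _, _, d, π', E, _, _, ι, hpres, hι, hhom⟩ := hN
  have := hpres.cover.projective
  have := hpres.cover_syzygy.projective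
  have : Module.Finite Λ P₀ := hpres.cover.finite
  have : Module.Finite Λ P₁ := hpres.cover_syzygy.finite
  obtain ⟨e₀⟩ := hpres.cover.nonempty_equiv hρ
  let f : P₀ ≃ₗ[Λ] P := e₀ ≪≫ₗ eQ
  let σ : P₀ →ₗ[Λ] S := π ∘ₗ f.toLinearMap
  have hσ : IsProjectiveCover σ := hπ.comp_equiv f
  have hker : LinearMap.ker π' ≤ LinearMap.ker σ := by
    apply hσ.le_ker_of_ne_top
    intro h
    obtain ⟨y, hy⟩ := exists_ne (0 : N)
    obtain ⟨x, rfl⟩ := hpres.cover.surjective y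
    exact hy (LinearMap.mem_ker.1 (h ▸ Submodule.mem_top))
  by_cases hbot : LinearMap.ker π' = ⊥
  · exact Module.Projective.of_equiv (LinearEquiv.ofBijective π'
      ⟨LinearMap.ker_eq_bot.1 hbot, hpres.cover.surjective⟩)
  exfalso
  have hdσ : ∀ x, d x ∈ LinearMap.ker σ := fun x =>
    hker (hpres.exact ▸ LinearMap.mem_range_self d x)
  -- the `S`-isotypic module `ker σ` and its non-zero submodule `range d`
  let c : P₁ →ₗ[Λ] (Fin n → S) := e.toLinearMap ∘ₗ (f.toLinearMap ∘ₗ d).codRestrict _ hdσ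
  obtain ⟨x, hx⟩ : ∃ x, d x ≠ 0 := by
    by_contra! h
    apply hbot
    rw [← hpres.exact, LinearMap.range_eq_bot]
    exact LinearMap.ext h
  have hcx : c x ≠ 0 := by
    intro h
    apply hx
    have h1 := (LinearEquiv.map_eq_zero_iff e).1 h
    exact (LinearEquiv.map_eq_zero_iff f).1 (congrArg Subtype.val h1)
  obtain ⟨i, hi⟩ := Function.ne_iff.1 hcx
  let q : P₁ →ₗ[Λ] S := LinearMap.proj i ∘ₗ c
  -- `π' ∘ t` is the map that cannot factor through `d`: composed with `σ' : N → S` it returns `q ≠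
  -- 0`, whereas `σ' ∘ g` vanishes on `ker σ`, which contains the image of `d`.
  obtain ⟨t, ht⟩ := Module.projective_lifting_property σ q hσ.surjective
  obtain ⟨g, hg⟩ := ARTranslate.exists_comp_eq_of_hom_eq_zero hι hhom (π' ∘ₗ t)
  obtain ⟨σ', hσ'⟩ := hpres.cover.exists_factorization σ
  have h1 : σ' (g (d x)) = q x := by
    rw [← LinearMap.comp_apply g, hg, LinearMap.comp_apply, ← LinearMap.comp_apply σ', hσ',
      ← LinearMap.comp_apply, ht]
  have h2 : σ' (g (d x)) = 0 :=
    hσ.ker_le_ker (σ' ∘ₗ g) (hdσ x)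
  exact hi (h1.symm.trans h2)

end TauRigid

/-! ### Assembly of the theorem. -/

theorem theorem4p1
    (R : Type u) [CommRing R] [IsArtinianRing R]
    (Λ : Type v) [Ring Λ] [Algebra R Λ] [Module.Finite R Λ]
    (S : Type v) [AddCommGroup S] [Module Λ S] [IsSimpleModule Λ S]
    (P : Type v) [AddCommGroup P] [Module Λ P] (π : P →ₗ[Λ] S) (hπ : IsProjectiveCover π)
    (hΩ_ne : Nontrivial (LinearMap.ker π)) (hΩ_ss : IsSemisimpleModule Λ (LinearMap.ker π)) :
    (¬ IsDirectSummand Λ S (LinearMap.ker π) →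
      ∀ S₁ : Submodule Λ (LinearMap.ker π), IsSimpleModule Λ S₁ →
      ∀ m : ℕ, IsMaximalMultiplicity Λ S₁ (LinearMap.ker π) m →
      ∀ T T' : Submodule Λ (LinearMap.ker π), IsCompl T T' → Nonempty ((Fin m → S₁) ≃ₗ[Λ] T) →
      ∃ (M : Type v) (_ : AddCommGroup M) (_ : Module Λ M)
        (i : (LinearMap.ker π ⧸ T) →ₗ[Λ] P) (p : P →ₗ[Λ] M),
        Function.Injective i ∧ Function.Exact i p ∧ Function.Surjective p ∧
        IsIndecomposableModule Λ M ∧ IsTauRigid R (Λ := Λ) M) ∧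
    (IsDirectSummand Λ S (LinearMap.ker π) →
      ∀ n : ℕ, IsMaximalMultiplicity Λ S (LinearMap.ker π) n →
      (Nonempty (LinearMap.ker π ≃ₗ[Λ] (Fin n → S)) →
        ¬ ∃ (N : Type v) (_ : AddCommGroup N) (_ : Module Λ N)
          (Q : Type v) (_ : AddCommGroup Q) (_ : Module Λ Q) (ρ : Q →ₗ[Λ] N),
          ¬ Module.Projective Λ N ∧ IsIndecomposableModule Λ N ∧ IsTauRigid R (Λ := Λ) N ∧
          IsProjectiveCover ρ ∧ Nonempty (Q ≃ₗ[Λ] P)) ∧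
      (¬ Nonempty (LinearMap.ker π ≃ₗ[Λ] (Fin n → S)) →
        ∀ T T' : Submodule Λ (LinearMap.ker π), IsCompl T T' → Nonempty ((Fin n → S) ≃ₗ[Λ] T) →
        ∃ (N : Type v) (_ : AddCommGroup N) (_ : Module Λ N)
          (i : (LinearMap.ker π ⧸ T) →ₗ[Λ] P) (p : P →ₗ[Λ] N),
          Function.Injective i ∧ Function.Exact i p ∧ Function.Surjective p ∧
          IsIndecomposableModule Λ N ∧ ¬ Module.Projective Λ N ∧ IsTauRigid R (Λ := Λ) N)) := by
  -- The quotient by `T` enters `P` as the complement `T'`, so the cokernel is `P / T'`.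
  have hinj : ∀ T T' : Submodule Λ (LinearMap.ker π), ∀ h : IsCompl T T',
      Function.Injective ((LinearMap.ker π).subtype ∘ₗ T'.subtype ∘ₗ
        (Submodule.quotientEquivOfIsCompl T T' h).toLinearMap) := fun T T' h =>
    (Submodule.injective_subtype _).comp ((Submodule.injective_subtype _).comp
      (LinearEquiv.injective _))
  have hexact : ∀ T T' : Submodule Λ (LinearMap.ker π), ∀ h : IsCompl T T',
      Function.Exact ((LinearMap.ker π).subtype ∘ₗ T'.subtype ∘ₗ
        (Submodule.quotientEquivOfIsCompl T T' h).toLinearMap)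
        (T'.map (LinearMap.ker π).subtype).mkQ := fun T T' h => by
    rw [LinearMap.exact_iff, Submodule.ker_mkQ, LinearMap.range_comp, LinearMap.range_comp,
      LinearEquiv.range, Submodule.map_top, Submodule.range_subtype]
  refine ⟨fun hS S₁ _ m hm T T' hT ⟨e⟩ => ?_, fun _ n hn => ⟨fun ⟨e⟩ => ?_, fun hne T T' hT ⟨e⟩ => ?_⟩⟩
  · refine ⟨P ⧸ T'.map (LinearMap.ker π).subtype, inferInstance, inferInstance, _, _,
      hinj T T' hT, hexact T T' hT, Submodule.mkQ_surjective _,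
      hπ.isIndecomposableModule_quotient (Submodule.map_subtype_le _ _),
      isTauRigid_quotient R hπ hT e (fun g => ?_) (hm.hom_eq_zero hT.disjoint e)⟩
    -- A non-zero map `T' → S` splits and would make `S` a summand of the syzygy.
    by_contra hg
    obtain ⟨s, hs⟩ := IsSemisimpleModule.lifting_property g (LinearMap.surjective_of_ne_zero hg)
      LinearMap.id
    have hsi : Function.Injective s :=
      (show Function.LeftInverse g s from fun x => LinearMap.congr_fun hs x).injective
    exact hS (IsDirectSummand.of_injective (f := T'.subtype ∘ₗ s)
      (T'.injective_subtype.comp hsi))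
  · rintro ⟨N, _, _, Q, _, _, ρ, hproj, hind, hrig, hρ, ⟨eQ⟩⟩
    have := hind.1
    exact hproj (hrig.projective_of_isotypic R hπ e hρ eQ)
  · have hz := hn.hom_eq_zero hT.disjoint e
    refine ⟨P ⧸ T'.map (LinearMap.ker π).subtype, inferInstance, inferInstance, _, _,
      hinj T T' hT, hexact T T' hT, Submodule.mkQ_surjective _,
      hπ.isIndecomposableModule_quotient (Submodule.map_subtype_le _ _),
      hπ.not_projective_quotient (Submodule.map_subtype_le _ _) (fun hbot => ?_),
      isTauRigid_quotient R hπ hT e hz hz⟩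
    -- Were `P / T'` projective because `T' = 0`, the whole syzygy would be `T ≅ S ^ n`.
    have hT' : T' = ⊥ := by
      apply Submodule.map_injective_of_injective (LinearMap.ker π).injective_subtype
      rw [hbot, Submodule.map_bot]
    have hTtop : T = ⊤ := by simpa [hT'] using hT.sup_eq_top
    exact hne ⟨(e ≪≫ₗ LinearEquiv.ofTop T hTtop).symm⟩
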